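/- Let $G$ be a group with identity $\mathrm{id}$. A circular ordering on $G$ is a function $f\colon G\times G\to\mathbb{Z}$ with values in $\{0,1\}$ such that $f(\mathrm{id},g)=f(g,\mathrm{id})=0$ for all $g\in G$, $f(h,k)-f(gh,k)+f(g,hk)-f(g,h)=0$ for all $g,h,k\in G$, and $f(g,g^{-1})=1$ for all $g\neq\mathrm{id}$. The group $G$ is circularly-orderable if it admits a circular ordering. A bi-invariant circular ordering on $G$ is a function $c\colon G^3\to\{0,\pm1\}$ such that (1) $c(g_1,g_2,g_3)=0$ if and only if $g_i=g_j$ for some $i\neq j$; (2) $c(g_2,g_3,g_4)-c(g_1,g_3,g_4)+c(g_1,g_2,g_4)-c(g_1,g_2,g_3)=0$ for all $g_1,g_2,g_3,g_4\in G$; (3) $c(g_1,g_2,g_3)=c(hg_1,hg_2,hg_3)=c(g_1h,g_2h,g_3h)$ for all $g_1,g_2,g_3,h\in G$. The obstruction spectrum of $G$ is $$\operatorname{Ob}(G)=\{\,n\in\mathbb{N},\ n\geq 2 \mid G\times\mathbb{Z}/n\mathbb{Z}\text{ is not circularly-orderable}\,\},$$ and $\min(\operatorname{Ob}(G))$ denotes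 the set of those elements of $\operatorname{Ob}(G)$ that are minimal with respect to divisibility. **Theorem.** Let $A$ be a group admitting a bi-invariant circular ordering, and let $G$ be a circularly-orderable group such that $\min(\operatorname{Ob}(G))$ consists only of prime numbers. Then $G\times A$ is circularly-orderable if and only if $\min(\operatorname{Ob}(G))\cap\min(\operatorname{Ob}(A))=\emptyset$. -/

import Mathlib

/-- A normalized inhomogeneous 2-cocycle on `G` with values in the trivial module `ℤ`. -/
structure IsInhomogeneousTwoCocycle {G : Type*} [Group G] (f : G → G → ℤ) : Prop where
  map_one_left : ∀ g : G, f 1 g = 0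
  map_one_right : ∀ g : G, f g 1 = 0
  cocycle : ∀ g h k : G, f h k - f (g * h) k + f g (h * k) - f g h = 0

/-- A circular ordering on `G`, as an inhomogeneous 2-cocycle. -/
structure IsCircularOrdering {G : Type*} [Group G] (f : G → G → ℤ) : Prop
    extends IsInhomogeneousTwoCocycle f where
  zero_or_one : ∀ g h : G, f g h = 0 ∨ f g h = 1
  map_inv : ∀ g : G, g ≠ 1 → f g g⁻¹ = 1

/-- A group is circularly-orderable if it admits a circular ordering. -/
def CircularlyOrderable (G : Type*) [Group G] : Prop :=
  ∃ f : G → G → ℤ, IsCircularOrdering f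

/-- A circular ordering on `G`, as a homogeneous cocycle `c : G³ → {0, ±1}`
(invariant under left multiplication). -/
structure IsHomogeneousCircularOrdering {G : Type*} [Group G] (c : G → G → G → ℤ) : Prop where
  values : ∀ x y z : G, c x y z = 0 ∨ c x y z = 1 ∨ c x y z = -1
  eq_zero_iff : ∀ x y z : G, c x y z = 0 ↔ (x = y ∨ y = z ∨ x = z)
  cocycle : ∀ x y z w : G, c y z w - c x z w + c x y w - c x y z = 0
  left_inv : ∀ h x y z : G, c (h * x) (h * y) (h * z) = c x y z

/-- A bi-invariant circular ordering: also invariant under right multiplication. -/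
structure IsBiInvariantCircularOrdering {G : Type*} [Group G] (c : G → G → G → ℤ) : Prop
    extends IsHomogeneousCircularOrdering c where
  right_inv : ∀ h x y z : G, c (x * h) (y * h) (z * h) = c x y z

/-- The group admits a bi-invariant circular ordering. -/
def BiCircularlyOrderable (G : Type*) [Group G] : Prop :=
  ∃ c : G → G → G → ℤ, IsBiInvariantCircularOrdering c

/-- The obstruction spectrum `Ob(G)`: those `n ≥ 2` such that `G × ℤ/nℤ` is not
circularly-orderable. -/
def obstructionSpectrum (G : Type*) [Group G] : Set ℕ :=
  {n | 2 ≤ n ∧ ¬ CircularlyOrderable (G × Multiplicative (ZMod n))}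

/-- The elements of `S` that are minimal in `S` with respect to divisibility. -/
def minDvd (S : Set ℕ) : Set ℕ :=
  {n | n ∈ S ∧ ∀ m ∈ S, m ∣ n → m = n}

/-!
Let `S` be the set of minimal elements of `Ob(G)`, a set of primes. Both directions follow from one
statement (`circularlyOrderable_prod`): if `A` has no `p`-torsion for `p ∈ S`, and `G × ℤ/n` is
circularly orderable for all `n` prime to `S`, then `G × A` is circularly orderable.

The bi-invariant circular ordering of `A` gives a cocycle `f` invariant under conjugation, and the
central extension of `A` by `ℤ = ⟨z⟩` with cocycle `f` is then bi-ordered with `z` cofinal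
(`IsCircularOrdering.conj_comm`, `CircularLift.mulRightMono`). Two facts follow.

* The translation number on the lift is a homomorphism to `ℝ` (`CircularLift.trans_mul`), so the
  rotation number is a homomorphism `A → ℝ/ℤ` with no non-trivial torsion element in its kernel
  (`IsCircularOrdering.exists_rotation`). A `ℚ`-linear retraction `ℝ → ℚ` turns it into a
  homomorphism `θ : A → ℚ ⧸ ℤ[S⁻¹]` killing no element of prime order outside `S`.
* A torsion-free subgroup of `A` is left-orderable: it acts on the ordered lift by conjugation, with
  central kernel (`IsCircularOrdering.leftOrderable_of_torsionFree_subgroup`).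

Hence `ker θ` is left-orderable. The group `G × ℚ ⧸ ℤ[S⁻¹]` is circularly orderable by compactness,
since `ℚ ⧸ ℤ[S⁻¹]` is a union of finite cyclic groups of order prime to `S`, and a lexicographic
ordering (`CircularlyOrderable.of_ker`) lifts this to `G × A`.

If `S` is disjoint from the minimal elements of `Ob(A)`, then `A × ℤ/p` is circularly orderable for
`p ∈ S`, so `A` has no `p`-torsion, because `ℤ/p × ℤ/p` is not circularly orderable. Conversely,
suppose `G × A` is circularly orderable and `p ∈ S`. Then `A` has no `p`-torsion, and the key
statement applied to `ℤ/p` in place of `G` and `{p}` in place of `S` shows `p ∉ Ob(A)`.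
-/

/-! ### Left-orderable groups -/

/-- A group is left-orderable if it has a positive cone: a subsemigroup not containing the
identity which contains one of `a`, `a⁻¹` for every `a ≠ 1`. -/
def LeftOrderable (H : Type*) [Group H] : Prop :=
  ∃ P : Set H, (∀ a ∈ P, ∀ b ∈ P, a * b ∈ P) ∧ 1 ∉ P ∧ ∀ a, a ≠ 1 → a ∈ P ∨ a⁻¹ ∈ P

namespace LeftOrderable

theorem of_injective {H K : Type*} [Group H] [Group K] (φ : H →* K)
    (hφ : Function.Injective φ) (hK : LeftOrderable K) : LeftOrderable H := by
  obtain ⟨P, hmul, hone, htot⟩ := hK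
  refine ⟨φ ⁻¹' P, fun a ha b hb => ?_, ?_, fun a ha => ?_⟩
  · simpa using hmul _ ha _ hb
  · simpa using hone
  · simpa using htot (φ a) (by simpa using fun h => ha (hφ (by simpa using h)))

/-- The lexicographic order: an extension of a left-orderable group by a left-orderable group is
left-orderable. -/
theorem of_ker {H Q : Type*} [Group H] [Group Q] (π : H →* Q) (hQ : LeftOrderable Q)
    (hker : LeftOrderable π.ker) : LeftOrderable H := by
  obtain ⟨P, hmul, hone, htot⟩ := hQ
  obtain ⟨R, rmul, rone, rtot⟩ := hker
  refine ⟨{h | π h ∈ P ∨ ∃ hh : π h = 1, (⟨h, hh⟩ : π.ker) ∈ R}, ?_, ?_, ?_⟩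
  · rintro a (ha | ⟨ha, ha'⟩) b (hb | ⟨hb, hb'⟩)
    · left; simpa using hmul _ ha _ hb
    · left; simpa [hb] using ha
    · left; simpa [ha] using hb
    · right; exact ⟨by simp [ha, hb], rmul _ ha' _ hb'⟩
  · rintro (h | ⟨h, h'⟩)
    · exact hone (by simpa using h)
    · exact rone h'
  · intro a ha
    by_cases h : π a = 1
    · rcases rtot ⟨a, h⟩ (by simpa [Subtype.ext_iff] using ha) with h' | h'
      · exact Or.inl (Or.inr ⟨h, h'⟩)
      · exact Or.inr (Or.inr ⟨by simp [h], h'⟩)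
    · rcases htot _ h with h' | h'
      · exact Or.inl (Or.inl h')
      · exact Or.inr (Or.inl (by simpa using h'))

/-- Fix a well-order on `X`. An automorphism is declared positive when it moves upwards the first
point, for the well-order, that it moves at all. -/
theorem orderIso (X : Type*) [LinearOrder X] : LeftOrderable (X ≃o X) := by
  let r : X → X → Prop := WellOrderingRel
  have key : ∀ g : X ≃o X, g ≠ 1 → ∃ x, g x ≠ x ∧ ∀ y, r y x → g y = y := by
    intro g hg
    have hne : {x | g x ≠ x}.Nonempty := by
      by_contra hcon
      rw [Set.not_nonempty_iff_eq_empty] at hcon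
      refine hg (RelIso.ext fun x => ?_)
      by_contra hx
      exact (Set.eq_empty_iff_forall_notMem.1 hcon x) hx
    have wf : WellFounded r := IsWellFounded.wf
    refine ⟨wf.min _ hne, wf.min_mem _ hne, fun y hy => ?_⟩
    by_contra hy'
    exact wf.not_lt_min {x | g x ≠ x} hy' hy
  refine ⟨{g | ∃ x, x < g x ∧ ∀ y, r y x → g y = y}, ?_, ?_, ?_⟩
  · rintro g ⟨x, hx, hx'⟩ h ⟨y, hy, hy'⟩
    rcases trichotomous_of r x y with hxy | rfl | hxy
    · refine ⟨x, ?_, fun w hw => ?_⟩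
      · rw [RelIso.mul_apply, hy' x hxy]; exact hx
      · rw [RelIso.mul_apply, hy' w (_root_.trans hw hxy), hx' w hw]
    · refine ⟨x, ?_, fun w hw => ?_⟩
      · rw [RelIso.mul_apply]; exact hx.trans (g.lt_iff_lt.2 hy)
      · rw [RelIso.mul_apply, hy' w hw, hx' w hw]
    · refine ⟨y, ?_, fun w hw => ?_⟩
      · rw [RelIso.mul_apply]
        calc y = g y := (hx' y hxy).symm
          _ < g (h y) := g.lt_iff_lt.2 hy
      · rw [RelIso.mul_apply, hy' w hw, hx' w (_root_.trans hw hxy)]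
  · rintro ⟨x, hx, -⟩
    exact lt_irrefl _ hx
  · intro g hg
    obtain ⟨x, hx, hx'⟩ := key g hg
    rcases lt_or_gt_of_ne hx with h | h
    · refine Or.inr ⟨x, ?_, fun y hy => ?_⟩
      · rw [← g.lt_iff_lt]
        simpa using h
      · rw [← g.injective.eq_iff]
        simpa using (hx' y hy).symm
    · exact Or.inl ⟨x, h, hx'⟩

/-- A maximal subsemigroup avoiding the identity is a positive cone of a torsion-free abelian
group. -/
theorem of_torsionFree {C : Type*} [Group C] (hcomm : ∀ a b : C, a * b = b * a)
    (htf : ∀ (a : C) (n : ℕ), 0 < n → a ^ n = 1 → a = 1) : LeftOrderable C := by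
  let 𝒮 : Set (Set C) := {P | (∀ a ∈ P, ∀ b ∈ P, a * b ∈ P) ∧ 1 ∉ P}
  obtain ⟨P, hP⟩ : ∃ P, Maximal (· ∈ 𝒮) P := by
    refine zorn_subset 𝒮 fun c hc hchain => ⟨⋃₀ c, ⟨?_, ?_⟩, fun s hs => Set.subset_sUnion_of_mem hs⟩
    · rintro a ⟨s, hs, ha⟩ b ⟨t, ht, hb⟩
      rcases hchain.total hs ht with h | h
      · exact ⟨t, ht, (hc ht).1 _ (h ha) _ hb⟩
      · exact ⟨s, hs, (hc hs).1 _ ha _ (h hb)⟩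
    · rintro ⟨s, hs, h⟩
      exact (hc hs).2 h
  have hmul := hP.1.1
  have hone := hP.1.2
  have hpow : ∀ a ∈ P, ∀ n : ℕ, 0 < n → a ^ n ∈ P := by
    intro a ha n hn
    induction n, hn using Nat.le_induction with
    | base => simpa using ha
    | succ n _ ih => rw [pow_succ]; exact hmul _ ih _ ha
  -- An element outside `P` cannot be adjoined to `P`, so a power of it is inverse to a point of `P`.
  have key : ∀ a, a ≠ 1 → a ∉ P → ∃ n : ℕ, 0 < n ∧ (a⁻¹) ^ n ∈ P := by
    intro a ha haP
    by_contra! hcon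
    refine haP (hP.2 (y := P ∪ {x | ∃ n : ℕ, 0 < n ∧ (x = a ^ n ∨ ∃ p ∈ P, x = p * a ^ n)})
      ⟨?_, ?_⟩ Set.subset_union_left (Or.inr ⟨1, one_pos, Or.inl (pow_one a).symm⟩))
    · rintro x (hx | ⟨n, hn, rfl | ⟨p, hp, rfl⟩⟩) y (hy | ⟨m, hm, rfl | ⟨q, hq, rfl⟩⟩)
      · exact Or.inl (hmul _ hx _ hy)
      · exact Or.inr ⟨m, hm, Or.inr ⟨x, hx, rfl⟩⟩
      · exact Or.inr ⟨m, hm, Or.inr ⟨x * q, hmul _ hx _ hq, by rw [mul_assoc]⟩⟩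
      · exact Or.inr ⟨n, hn, Or.inr ⟨y, hy, hcomm _ _⟩⟩
      · exact Or.inr ⟨n + m, by omega, Or.inl (pow_add _ _ _).symm⟩
      · exact Or.inr ⟨n + m, by omega, Or.inr ⟨q, hq, by
          rw [← mul_assoc, hcomm _ q, mul_assoc, pow_add]⟩⟩
      · exact Or.inr ⟨n, hn, Or.inr ⟨p * y, hmul _ hp _ hy, by
          rw [mul_assoc, hcomm _ y, mul_assoc]⟩⟩
      · exact Or.inr ⟨n + m, by omega, Or.inr ⟨p, hp, by rw [mul_assoc, pow_add]⟩⟩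
      · exact Or.inr ⟨n + m, by omega, Or.inr ⟨p * q, hmul _ hp _ hq, by
          rw [mul_assoc, ← mul_assoc _ q, hcomm _ q, mul_assoc, mul_assoc, pow_add]⟩⟩
    · rintro (h | ⟨n, hn, h | ⟨p, hp, h⟩⟩)
      · exact hone h
      · exact ha (htf a n hn h.symm)
      · refine hcon n hn ?_
        rw [inv_pow, ← eq_inv_of_mul_eq_one_left h.symm]
        exact hp
  refine ⟨P, hmul, hone, fun a ha => ?_⟩
  by_contra! hcon
  obtain ⟨n, hn, hn'⟩ := key a ha hcon.1
  obtain ⟨m, hm, hm'⟩ := key a⁻¹ (by simpa using ha) hcon.2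
  rw [inv_inv] at hm'
  refine hone ?_
  have := hmul _ (hpow _ hn' m hm) _ (hpow _ hm' n hn)
  rwa [← pow_mul, ← pow_mul, mul_comm n m, inv_pow, inv_mul_cancel] at this

end LeftOrderable

/-! ### Constructions of circular orderings -/

theorem IsCircularOrdering.eq_one_of_apply_inv_eq_zero {H : Type*} [Group H] {f : H → H → ℤ}
    (hf : IsCircularOrdering f) {a : H} (h : f a a⁻¹ = 0) : a = 1 := by
  by_contra ha
  have := hf.map_inv a ha
  omega

namespace CircularlyOrderable

theorem of_injective {H K : Type*} [Group H] [Group K] (φ : H →* K)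
    (hφ : Function.Injective φ) (hK : CircularlyOrderable K) : CircularlyOrderable H := by
  obtain ⟨f, hf⟩ := hK
  refine ⟨fun a b => f (φ a) (φ b), ⟨⟨?_, ?_, ?_⟩, ?_, ?_⟩⟩
  · intro g; simpa using hf.map_one_left _
  · intro g; simpa using hf.map_one_right _
  · intro g h k; simpa using hf.cocycle _ _ _
  · intro g h; exact hf.zero_or_one _ _
  · intro g hg
    simpa using hf.map_inv (φ g) (by simpa using fun h => hg (hφ (by simpa using h)))

open Classical in
/-- The lexicographic circular order: if the quotient is circularly orderable and the kernel is
left-orderable, the pulled-back cocycle is corrected by the coboundary of the indicator function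
of the negative elements of the kernel. -/
theorem of_ker {H Q : Type*} [Group H] [Group Q] (π : H →* Q) (hQ : CircularlyOrderable Q)
    (hker : LeftOrderable π.ker) : CircularlyOrderable H := by
  obtain ⟨f, hf⟩ := hQ
  obtain ⟨R, rmul, rone, rtot⟩ := hker
  let N : Set H := {h | ∃ hh : π h = 1, (⟨h, hh⟩ : π.ker)⁻¹ ∈ R}
  have hN1 : ∀ a ∈ N, π a = 1 := fun a ha => ha.1
  have hNmul : ∀ a ∈ N, ∀ b ∈ N, a * b ∈ N := by
    rintro a ⟨ha, ha'⟩ b ⟨hb, hb'⟩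
    refine ⟨by simp [ha, hb], ?_⟩
    have := rmul _ hb' _ ha'
    rwa [← mul_inv_rev] at this
  have hNone : (1 : H) ∉ N := by
    rintro ⟨h, h'⟩
    refine rone ?_
    rwa [show (⟨1, h⟩ : π.ker) = 1 from rfl, inv_one] at h'
  have hNtot : ∀ a, a ≠ 1 → π a = 1 → a ∈ N ∨ a⁻¹ ∈ N := by
    intro a ha h
    rcases rtot ⟨a, h⟩ (by simpa [Subtype.ext_iff] using ha) with h' | h'
    · refine Or.inr ⟨by simp [h], ?_⟩
      convert h'
      simp [Subtype.ext_iff]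
    · exact Or.inl ⟨h, h'⟩
  have hNinv : ∀ a ∈ N, a⁻¹ ∉ N := fun a ha hb => hNone (by simpa using hNmul _ ha _ hb)
  -- For `a, b` in the kernel, `a * b` is negative only if `a` or `b` is.
  have hNor : ∀ a b, π a = 1 → π b = 1 → a * b ∈ N → a ∈ N ∨ b ∈ N := by
    intro a b ha hb hab
    by_contra! hcon
    by_cases h1 : a = 1
    · exact hcon.2 (by simpa [h1] using hab)
    by_cases h2 : b = 1
    · exact hcon.1 (by simpa [h2] using hab)
    have := hNmul _ ((hNtot b h2 hb).resolve_left hcon.2) _ ((hNtot a h1 ha).resolve_left hcon.1)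
    rw [← mul_inv_rev] at this
    exact hNinv _ hab this
  let d : H → ℤ := fun h => if h ∈ N then 1 else 0
  have dpos : ∀ h, h ∈ N → d h = 1 := fun h hh => if_pos hh
  have dneg : ∀ h, h ∉ N → d h = 0 := fun h hh => if_neg hh
  have d01 : ∀ h, d h = 0 ∨ d h = 1 := fun h => by
    by_cases hh : h ∈ N
    · exact Or.inr (dpos _ hh)
    · exact Or.inl (dneg _ hh)
  have dker : ∀ h, π h ≠ 1 → d h = 0 := fun h hh => dneg _ fun h' => hh (hN1 _ h')
  refine ⟨fun g h => f (π g) (π h) + d g + d h - d (g * h), ⟨⟨?_, ?_, ?_⟩, ?_, ?_⟩⟩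
  · intro g
    simp [hf.map_one_left, dneg _ hNone]
  · intro g
    simp [hf.map_one_right, dneg _ hNone]
  · intro g h k
    have := hf.cocycle (π g) (π h) (π k)
    simp only [map_mul, mul_assoc]
    linarith
  · intro g h
    by_cases hg : π g = 1 <;> by_cases hh : π h = 1
    · simp only [hg, hf.map_one_left]
      by_cases h1 : g ∈ N <;> by_cases h2 : h ∈ N
      · rw [dpos _ h1, dpos _ h2, dpos _ (hNmul _ h1 _ h2)]; simp
      · rw [dpos _ h1, dneg _ h2]; have := d01 (g * h); omega
      · rw [dneg _ h1, dpos _ h2]; have := d01 (g * h); omega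
      · rw [dneg _ h1, dneg _ h2, dneg _ fun h3 => by
          rcases hNor _ _ hg hh h3 with h4 | h4
          exacts [h1 h4, h2 h4]]
        simp
    · simp only [hg, hf.map_one_left]
      rw [dker h hh, dker (g * h) (by simpa [hg] using hh)]
      have := d01 g; omega
    · simp only [hh, hf.map_one_right]
      rw [dker g hg, dker (g * h) (by simpa [hh] using hg)]
      have := d01 h; omega
    · simp only [dker h hh, dker g hg]
      by_cases hgh : π (g * h) = 1
      · have h1 : π h = (π g)⁻¹ := 
          eq_inv_of_mul_eq_one_right (by simpa using hgh)
        rw [h1, hf.map_inv _ hg]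
        have := d01 (g * h); omega
      · rw [dker _ hgh]
        have := hf.zero_or_one (π g) (π h); omega
  · intro g hg
    simp only [mul_inv_cancel, dneg _ hNone, map_inv]
    by_cases h : π g = 1
    · rw [h, inv_one, hf.map_one_left]
      rcases hNtot g hg h with h' | h'
      · rw [dpos _ h', dneg _ (hNinv _ h')]; simp
      · rw [dpos _ h', dneg _ fun h'' => hNinv _ h'' h']; simp
    · rw [hf.map_inv _ h, dker g h, dker g⁻¹ (by simpa using h)]; simp

open Filter in
open Classical in
/-- Compactness: a group which is locally approximated by circularly orderable groups is
circularly orderable, the cocycle being an ultralimit of cocycles on the approximating groups. -/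
theorem of_eventually {H : Type*} [Group H] {L : ℕ → Type*} [∀ n, Group (L n)]
    (hL : ∀ n, CircularlyOrderable (L n)) (s : ∀ n, H → L n)
    (hmul : ∀ x y, ∀ᶠ n in atTop, s n (x * y) = s n x * s n y)
    (hone : ∀ x, x ≠ 1 → ∀ᶠ n in atTop, s n x ≠ 1) : CircularlyOrderable H := by
  choose f hf using hL
  let U : Ultrafilter ℕ := hyperfilter ℕ
  have hU : (U : Filter ℕ) ≤ atTop := Nat.hyperfilter_le_atTop
  let F : H → H → ℤ := fun x y => if ∀ᶠ n in (U : Filter ℕ), f n (s n x) (s n y) = 1 then 1 else 0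
  have hF : ∀ x y, ∀ᶠ n in (U : Filter ℕ), F x y = f n (s n x) (s n y) := by
    intro x y
    by_cases h : ∀ᶠ n in (U : Filter ℕ), f n (s n x) (s n y) = 1
    · simp only [F, if_pos h]
      filter_upwards [h] with n hn using hn.symm
    · simp only [F, if_neg h]
      filter_upwards [Ultrafilter.eventually_not.2 h] with n hn
      exact (((hf n).zero_or_one _ _).resolve_right hn).symm
  have hmulU : ∀ x y, ∀ᶠ n in (U : Filter ℕ), s n (x * y) = s n x * s n y :=
    fun x y => hU (hmul x y)
  have hmap_one : ∀ᶠ n in (U : Filter ℕ), s n 1 = 1 := by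
    filter_upwards [hmulU 1 1] with n hn
    simpa using hn
  refine ⟨F, ⟨⟨?_, ?_, ?_⟩, ?_, ?_⟩⟩
  · intro g
    obtain ⟨n, h1, h2⟩ := (hmap_one.and (hF 1 g)).exists
    rw [h2, h1, (hf n).map_one_left]
  · intro g
    obtain ⟨n, h1, h2⟩ := (hmap_one.and (hF g 1)).exists
    rw [h2, h1, (hf n).map_one_right]
  · intro g h k
    obtain ⟨n, h1, h2, h3, h4, h5, h6⟩ := ((hF h k).and ((hF (g * h) k).and ((hF g (h * k)).and
      ((hF g h).and ((hmulU g h).and (hmulU h k)))))).exists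
    rw [h1, h2, h3, h4, h5, h6, (hf n).cocycle]
  · intro g h
    obtain ⟨n, hn⟩ := (hF g h).exists
    rw [hn]
    exact (hf n).zero_or_one _ _
  · intro g hg
    obtain ⟨n, h1, h2, h3, h4⟩ := ((hF g g⁻¹).and ((hmulU g g⁻¹).and (hmap_one.and
      (hU (hone g hg))))).exists
    rw [mul_inv_cancel, h3] at h2
    rw [h1, ← inv_eq_of_mul_eq_one_right h2.symm, (hf n).map_inv _ h4]

/-- Finite cyclic groups are circularly orderable: the cocycle is the carry of addition of
residues. -/
theorem zmod (n : ℕ) [NeZero n] : CircularlyOrderable (Multiplicative (ZMod n)) := by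
  have key : ∀ a b : ZMod n, a.val + b.val = (a + b).val ∨ a.val + b.val = (a + b).val + n := by
    intro a b
    rcases lt_or_ge (a.val + b.val) n with h | h
    · exact Or.inl (ZMod.val_add_of_lt h).symm
    · right; have := ZMod.val_add_of_le h; omega
  have hn : (0 : ℤ) < n := by exact_mod_cast Nat.pos_of_ne_zero (NeZero.ne n)
  have key' : ∀ a b : ZMod n, ∃ k : ℤ, (k = 0 ∨ k = 1) ∧
      (a.val : ℤ) + b.val = (a + b).val + k * n := by
    intro a b
    rcases key a b with h | h
    · exact ⟨0, Or.inl rfl, by rw [zero_mul, add_zero]; exact_mod_cast h⟩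
    · exact ⟨1, Or.inr rfl, by rw [one_mul]; exact_mod_cast h⟩
  choose k hk01 hk using key'
  have cancel : ∀ x y : ℤ, x * n = y * n → x = y := fun x y h =>
    mul_right_cancel₀ hn.ne' h
  refine ⟨fun a b => k a.toAdd b.toAdd, ⟨⟨?_, ?_, ?_⟩, ?_, ?_⟩⟩
  · intro g
    refine cancel _ _ ?_
    have := hk 0 g.toAdd
    simp only [ZMod.val_zero, zero_add, toAdd_one] at this ⊢
    push_cast at this; linarith
  · intro g
    refine cancel _ _ ?_
    have := hk g.toAdd 0
    simp only [ZMod.val_zero, add_zero, toAdd_one] at this ⊢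
    push_cast at this; linarith
  · intro g h l
    refine cancel _ _ ?_
    simp only [toAdd_mul]
    have h1 := hk h.toAdd l.toAdd
    have h2 := hk (g.toAdd + h.toAdd) l.toAdd
    have h3 := hk g.toAdd (h.toAdd + l.toAdd)
    have h4 := hk g.toAdd h.toAdd
    rw [add_assoc] at h2
    linarith
  · intro g h; exact hk01 _ _
  · intro g hg
    refine (hk01 _ _).resolve_left fun h0 => hg ?_
    have := hk g.toAdd g⁻¹.toAdd
    rw [toAdd_inv] at this h0
    rw [h0, add_neg_cancel, ZMod.val_zero] at this
    have h1 : g.toAdd.val = 0 := by push_cast at this; omega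
    exact (ZMod.val_eq_zero _).1 h1

end CircularlyOrderable

open Filter Topology

/-! ### The central extension attached to a circular ordering -/

/-- For a cocycle invariant under conjugation, `b ↦ f a b - f (a * b * a⁻¹) a` is a homomorphism
to `ℤ`; being bounded, it vanishes. -/
theorem IsCircularOrdering.conj_comm {A : Type*} [Group A] {f : A → A → ℤ}
    (hf : IsCircularOrdering f) (hconj : ∀ x a b, f (x * a * x⁻¹) (x * b * x⁻¹) = f a b)
    (a b : A) : f (a * b * a⁻¹) a = f a b := by
  have h1 := hf.cocycle a b b
  have h2 := hf.cocycle (a * b * a⁻¹) (a * b * a⁻¹) a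
  have h3 := hf.cocycle (a * b * a⁻¹) a b
  have e1 : a * b * a⁻¹ * (a * b * a⁻¹) = a * (b * b) * a⁻¹ := by group
  have e2 : a * b * a⁻¹ * a = a * b := by group
  rw [e1, e2, hconj] at h2
  rw [e2] at h3
  have i1 := hf.zero_or_one a (b * b)
  have i2 := hf.zero_or_one (a * (b * b) * a⁻¹) a
  omega

/-- The central extension `1 → ℤ → CircularLift hf → A → 1` with cocycle `f`. The element
`⟨n, a⟩` lies in the interval `[z ^ n, z ^ (n + 1))`, where `z = ⟨1, 1⟩`, of the left order
below. -/
@[ext]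
structure CircularLift {A : Type*} [Group A] {f : A → A → ℤ} (hf : IsCircularOrdering f) where
  level : ℤ
  pt : A

namespace CircularLift

variable {A : Type*} [Group A] {f : A → A → ℤ} {hf : IsCircularOrdering f}

instance : Mul (CircularLift hf) := ⟨fun x y => ⟨x.level + y.level + f x.pt y.pt, x.pt * y.pt⟩⟩
instance : One (CircularLift hf) := ⟨⟨0, 1⟩⟩
instance : Inv (CircularLift hf) := ⟨fun x => ⟨-x.level - f x.pt⁻¹ x.pt, x.pt⁻¹⟩⟩

@[simp] theorem level_mul (x y : CircularLift hf) :
    (x * y).level = x.level + y.level + f x.pt y.pt := rfl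
@[simp] theorem pt_mul (x y : CircularLift hf) : (x * y).pt = x.pt * y.pt := rfl
@[simp] theorem level_one : (1 : CircularLift hf).level = 0 := rfl
@[simp] theorem pt_one : (1 : CircularLift hf).pt = 1 := rfl
@[simp] theorem level_inv (x : CircularLift hf) :
    x⁻¹.level = -x.level - f x.pt⁻¹ x.pt := rfl
@[simp] theorem pt_inv (x : CircularLift hf) : x⁻¹.pt = x.pt⁻¹ := rfl

instance : Group (CircularLift hf) :=
  Group.ofLeftAxioms
    (fun x y w => by
      ext
      · have := hf.cocycle x.pt y.pt w.pt
        simp only [level_mul, pt_mul]; omega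
      · simp [mul_assoc])
    (fun x => by ext <;> simp [hf.map_one_left])
    (fun x => by
      ext
      · simp only [level_mul, level_inv, pt_inv, level_one]; ring
      · simp)

theorem level_add_le (x y : CircularLift hf) : x.level + y.level ≤ (x * y).level := by
  have := hf.zero_or_one x.pt y.pt
  rw [level_mul]; omega

theorem level_le_add (x y : CircularLift hf) : (x * y).level ≤ x.level + y.level + 1 := by
  have := hf.zero_or_one x.pt y.pt
  rw [level_mul]; omega

/-- The left order on the lift, whose non-negative elements are those of non-negative level. -/
noncomputable instance : LinearOrder (CircularLift hf) where
  le x y := 0 ≤ (x⁻¹ * y).level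
  le_refl x := by rw [inv_mul_cancel]; rfl
  le_trans x y w h1 h2 := by
    have h3 : x⁻¹ * w = x⁻¹ * y * (y⁻¹ * w) := by group
    have := level_add_le (x⁻¹ * y) (y⁻¹ * w)
    rw [← h3] at this
    exact (add_nonneg h1 h2).trans this
  le_antisymm x y h1 h2 := by
    have h3 : y⁻¹ * x = (x⁻¹ * y)⁻¹ := by group
    rw [h3] at h2
    set u := x⁻¹ * y with hu
    rw [level_inv] at h2
    have h4 := hf.zero_or_one u.pt⁻¹ u.pt
    have h5 : u.pt⁻¹ = 1 := hf.eq_one_of_apply_inv_eq_zero (by rw [inv_inv]; omega)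
    have h6 : u = 1 := by
      ext
      · simp only [level_one]; omega
      · simpa using h5
    exact inv_mul_eq_one.1 (hu ▸ h6)
  le_total x y := by
    have h3 : y⁻¹ * x = (x⁻¹ * y)⁻¹ := by group
    rw [h3]
    set u := x⁻¹ * y
    rw [level_inv]
    have h4 := hf.zero_or_one u.pt⁻¹ u.pt
    omega
  toDecidableLE := Classical.decRel _

theorem le_def (x y : CircularLift hf) : x ≤ y ↔ 0 ≤ (x⁻¹ * y).level := Iff.rfl

instance : MulLeftMono (CircularLift hf) := ⟨fun g x y h => by
  rw [le_def] at h ⊢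
  rwa [show (g * x)⁻¹ * (g * y) = x⁻¹ * y by group]⟩

theorem level_mono {x y : CircularLift hf} (h : x ≤ y) : x.level ≤ y.level := by
  have h1 := level_add_le x (x⁻¹ * y)
  rw [mul_inv_cancel_left] at h1
  rw [le_def] at h
  omega

/-- If the cocycle is invariant under conjugation, the order on the lift is bi-invariant. -/
theorem mulRightMono (hconj : ∀ x a b, f (x * a * x⁻¹) (x * b * x⁻¹) = f a b) :
    MulRightMono (CircularLift hf) := ⟨fun g x y h => by
  change x * g ≤ y * g
  have key : ∀ g u : CircularLift hf, (g * u * g⁻¹).level = u.level := by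
    intro g u
    have h1 : (g * u * g⁻¹ * g).level = (g * u).level := by rw [inv_mul_cancel_right]
    rw [level_mul (g * u * g⁻¹), level_mul g u, pt_mul, pt_mul, pt_inv,
      hf.conj_comm hconj] at h1
    omega
  rw [le_def] at h ⊢
  rw [show (x * g)⁻¹ * (y * g) = g⁻¹ * (x⁻¹ * y) * g⁻¹⁻¹ by group, key]
  exact h⟩

end CircularLift

/-! ### Translation and rotation numbers -/

/-- In a bi-ordered group with `x * y ≤ y * x`, the power `(x * y) ^ n` arises from `x ^ n * y ^ n`
by increasing transpositions of neighbours, and `y ^ n * x ^ n` arises so from it. -/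
theorem pow_mul_pow_le_mul_pow_le {E : Type*} [Group E] [LinearOrder E] [MulLeftMono E]
    [MulRightMono E] {x y : E} (h : x * y ≤ y * x) (n : ℕ) :
    x ^ n * y ^ n ≤ (x * y) ^ n ∧ (x * y) ^ n ≤ y ^ n * x ^ n := by
  induction n with
  | zero => simp
  | succ n ih =>
    have e1 : (x * y) ^ (n + 1) = x * (y * x) ^ n * y := by
      rw [pow_succ', mul_assoc x y, ← (show SemiconjBy y (x * y) (y * x) by
        simp [SemiconjBy, mul_assoc]).pow_right n |>.eq.symm]
      simp only [mul_assoc]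
    have e2 : (y * x) ^ (n + 1) = y * (x * y) ^ n * x := by
      rw [pow_succ', mul_assoc y x, ← (show SemiconjBy x (y * x) (x * y) by
        simp [SemiconjBy, mul_assoc]).pow_right n |>.eq.symm]
      simp only [mul_assoc]
    constructor
    · rw [e1, pow_succ', pow_succ, show x * x ^ n * (y ^ n * y) = x * (x ^ n * y ^ n) * y by
        simp only [mul_assoc]]
      exact mul_le_mul_left (mul_le_mul_right (ih.1.trans (pow_le_pow_left' h n)) _) _
    · refine (pow_le_pow_left' h (n + 1)).trans ?_
      rw [e2, pow_succ', pow_succ, show y * y ^ n * (x ^ n * x) = y * (y ^ n * x ^ n) * x by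
        simp only [mul_assoc]]
      exact mul_le_mul_left (mul_le_mul_right ih.2 _) _

namespace CircularLift

variable {A : Type*} [Group A] {f : A → A → ℤ} {hf : IsCircularOrdering f}

theorem tendsto_level_pow_div (x : CircularLift hf) :
    ∃ t : ℝ, Tendsto (fun n : ℕ => ((x ^ n).level : ℝ) / n) atTop (𝓝 t) := by
  have hsub : Subadditive fun n : ℕ => -((x ^ n).level : ℝ) := by
    intro m n
    have := level_add_le (x ^ m) (x ^ n)
    rw [← pow_add] at this
    have : ((x ^ m).level : ℝ) + (x ^ n).level ≤ (x ^ (m + n)).level := by exact_mod_cast this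
    linarith
  have hle : ∀ n : ℕ, (x ^ n).level ≤ n * (x.level + 1) := by
    intro n
    induction n with
    | zero => simp
    | succ n ih =>
      have := level_le_add (x ^ n) x
      rw [← pow_succ] at this
      push_cast
      linarith
  have hbdd : BddBelow (Set.range fun n : ℕ => -((x ^ n).level : ℝ) / n) := by
    refine ⟨-|(x.level + 1 : ℝ)|, ?_⟩
    rintro _ ⟨n, rfl⟩
    rcases n.eq_zero_or_pos with rfl | hn
    · simp
    · have hn' : (0 : ℝ) < n := by exact_mod_cast hn
      change _ ≤ -((x ^ n).level : ℝ) / n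
      rw [le_div_iff₀ hn']
      have h1 : ((x ^ n).level : ℝ) ≤ n * (x.level + 1) := by exact_mod_cast hle n
      nlinarith [le_abs_self (x.level + 1 : ℝ)]
  refine ⟨-hsub.lim, ?_⟩
  simpa [neg_div] using (hsub.tendsto_lim hbdd).neg

/-- The translation number of `x`, the limit of `(x ^ n).level / n`. -/
noncomputable def trans (x : CircularLift hf) : ℝ := (tendsto_level_pow_div x).choose

theorem tendsto_trans (x : CircularLift hf) :
    Tendsto (fun n : ℕ => ((x ^ n).level : ℝ) / n) atTop (𝓝 x.trans) :=
  (tendsto_level_pow_div x).choose_spec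

theorem central_pow (k : ℤ) (n : ℕ) : (⟨k, 1⟩ : CircularLift hf) ^ n = ⟨n * k, 1⟩ := by
  induction n with
  | zero => ext <;> simp
  | succ n ih =>
    rw [pow_succ, ih]
    ext
    · simp only [level_mul, hf.map_one_left]; push_cast; ring
    · simp

theorem trans_central (k : ℤ) : (⟨k, 1⟩ : CircularLift hf).trans = k := by
  refine tendsto_nhds_unique (tendsto_trans _) (tendsto_const_nhds.congr' ?_)
  filter_upwards [eventually_gt_atTop 0] with n hn
  have hn' : (n : ℝ) ≠ 0 := by exact_mod_cast hn.ne'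
  rw [central_pow]
  push_cast
  field_simp

/-- The translation number is additive for a bi-invariant order, because `(x * y) ^ n` lies between
`x ^ n * y ^ n` and `y ^ n * x ^ n`. -/
theorem trans_mul [MulRightMono (CircularLift hf)] (x y : CircularLift hf) :
    (x * y).trans = x.trans + y.trans := by
  have key : ∀ n : ℕ, (x ^ n).level + (y ^ n).level ≤ ((x * y) ^ n).level ∧
      ((x * y) ^ n).level ≤ (x ^ n).level + (y ^ n).level + 1 := by
    intro n
    have a1 := level_add_le (x ^ n) (y ^ n)
    have a2 := level_add_le (y ^ n) (x ^ n)
    have a3 := level_le_add (x ^ n) (y ^ n)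
    have a4 := level_le_add (y ^ n) (x ^ n)
    rcases le_total (x * y) (y * x) with h | h
    · obtain ⟨h1, h2⟩ := pow_mul_pow_le_mul_pow_le h n
      have := level_mono h1
      have := level_mono h2
      omega
    · -- Here `(x * y) ^ n` is compared through its inverse `(y⁻¹ * x⁻¹) ^ n`.
      have h' : y⁻¹ * x⁻¹ ≤ x⁻¹ * y⁻¹ := by
        rw [← mul_inv_rev, ← mul_inv_rev]
        exact inv_le_inv_iff.2 h
      obtain ⟨h1, h2⟩ := pow_mul_pow_le_mul_pow_le h' n
      rw [← mul_inv_rev, inv_pow, inv_pow, inv_pow, ← mul_inv_rev, inv_le_inv_iff] at h1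
      rw [← mul_inv_rev, inv_pow, inv_pow, inv_pow, ← mul_inv_rev, inv_le_inv_iff] at h2
      have := level_mono h1
      have := level_mono h2
      omega
  have hsum := (tendsto_trans x).add (tendsto_trans y)
  have hdiff : Tendsto (fun n : ℕ => (((x * y) ^ n).level : ℝ) / n -
      (((x ^ n).level : ℝ) / n + ((y ^ n).level : ℝ) / n)) atTop (𝓝 0) := by
    refine squeeze_zero (fun n => ?_) (fun n => ?_) tendsto_one_div_atTop_nhds_zero_nat
    · rw [← add_div, ← sub_div]
      refine div_nonneg ?_ n.cast_nonneg
      have : ((x ^ n).level : ℝ) + (y ^ n).level ≤ ((x * y) ^ n).level := by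
        exact_mod_cast (key n).1
      linarith
    · rw [← add_div, ← sub_div]
      refine div_le_div_of_nonneg_right ?_ n.cast_nonneg
      have : (((x * y) ^ n).level : ℝ) ≤ (x ^ n).level + (y ^ n).level + 1 := by
        exact_mod_cast (key n).2
      linarith
  have := tendsto_nhds_unique ((tendsto_trans (x * y)).sub hsum) hdiff
  linarith

theorem trans_pow [MulRightMono (CircularLift hf)] (x : CircularLift hf) (n : ℕ) :
    (x ^ n).trans = n * x.trans := by
  induction n with
  | zero =>
    rw [pow_zero, Nat.cast_zero, zero_mul]
    exact (trans_central (hf := hf) 0).trans Int.cast_zero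
  | succ n ih => rw [pow_succ, trans_mul, ih]; push_cast; ring

end CircularLift

namespace IsCircularOrdering
variable {A : Type*} [Group A] {f : A → A → ℤ}

/-- The rotation number of `a` is the class modulo `ℤ` of `τ a`, the translation number of the lift
of `a` of level zero. A conjugation-invariant circular ordering is a real coboundary `δτ`, and
`τ` modulo `ℤ` does not vanish on non-trivial torsion elements. -/
theorem exists_rotation (hf : IsCircularOrdering f)
    (hconj : ∀ x a b, f (x * a * x⁻¹) (x * b * x⁻¹) = f a b) :
    ∃ τ : A → ℝ, (∀ a b, τ a + τ b = τ (a * b) + f a b) ∧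
      ∀ (a : A) (m : ℕ), 0 < m → a ^ m = 1 →
        (∃ l : ℤ, m * τ a = l) ∧ ∀ k : ℤ, τ a = k → a = 1 := by
  have := CircularLift.mulRightMono (hf := hf) hconj
  let x : A → CircularLift hf := fun a => ⟨0, a⟩
  have hsplit : ∀ k a, (⟨k, a⟩ : CircularLift hf) = ⟨k, 1⟩ * x a := by
    intro k a
    ext <;> simp [x, hf.map_one_left]
  refine ⟨fun a => (x a).trans, fun a b => ?_, fun a m hm ha => ?_⟩
  · have h1 : x a * x b = ⟨f a b, 1⟩ * x (a * b) := by
      rw [← hsplit]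
      ext <;> simp [x]
    change (x a).trans + (x b).trans = (x (a * b)).trans + _
    rw [← CircularLift.trans_mul, h1, CircularLift.trans_mul, CircularLift.trans_central, add_comm]
  · have hpt : ∀ n : ℕ, (x a ^ n).pt = a ^ n := by
      intro n
      induction n with
      | zero => simp
      | succ n ih => rw [pow_succ, pow_succ, CircularLift.pt_mul, ih]
    have h1 : x a ^ m = ⟨(x a ^ m).level, 1⟩ := by
      ext
      · rfl
      · rw [hpt, ha]
    have h2 : m * (x a).trans = (x a ^ m).level := by
      rw [← CircularLift.trans_pow, h1, CircularLift.trans_central]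
    refine ⟨⟨_, h2⟩, fun k hk => ?_⟩
    change (x a).trans = k at hk
    -- The lift `⟨-k, 1⟩ * x a` of `a` has translation number zero and a central `m`-th power.
    have hcomm : Commute (⟨-k, 1⟩ : CircularLift hf) (x a) := by
      ext <;> simp [x, hf.map_one_left, hf.map_one_right]
    have h3 : (x a ^ m).level = m * k := by
      rw [hk] at h2
      exact_mod_cast h2.symm
    have h4 : (⟨-k, 1⟩ * x a) ^ m = 1 := by
      rw [hcomm.mul_pow, h1, CircularLift.central_pow, h3]
      ext <;> simp [hf.map_one_left]
    have h5 : (⟨-k, 1⟩ : CircularLift hf) * x a = 1 := by simpa [hm.ne'] using h4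
    have := congrArg CircularLift.pt h5
    simpa [x] using this

end IsCircularOrdering

/-! ### Bi-invariant circular orderings -/

namespace IsCircularOrdering

variable {A : Type*} [Group A] {f : A → A → ℤ}

/-- A group with a conjugation-invariant circular ordering acts by conjugation on its lift,
preserving the order. The kernel of this action is the centre, and a torsion-free abelian group is
left-orderable, so a torsion-free subgroup is left-orderable. -/
theorem leftOrderable_of_torsionFree_subgroup (hf : IsCircularOrdering f)
    (hconj : ∀ x a b, f (x * a * x⁻¹) (x * b * x⁻¹) = f a b) (N : Subgroup A)
    (hN : ∀ (a : A) (n : ℕ), a ∈ N → 0 < n → a ^ n = 1 → a = 1) : LeftOrderable N := by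
  have hmono : ∀ (a : A) (x y : CircularLift hf),
      (⟨x.level, a * x.pt * a⁻¹⟩ : CircularLift hf) ≤ ⟨y.level, a * y.pt * a⁻¹⟩ ↔ x ≤ y := by
    intro a x y
    rw [CircularLift.le_def, CircularLift.le_def]
    simp only [CircularLift.level_mul, CircularLift.level_inv, CircularLift.pt_inv]
    rw [show (a * x.pt * a⁻¹)⁻¹ = a * x.pt⁻¹ * a⁻¹ by group, hconj, hconj]
  let ψ : N →* (CircularLift hf ≃o CircularLift hf) :=
    { toFun := fun a =>
        { toFun := fun x => ⟨x.level, a * x.pt * (a : A)⁻¹⟩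
          invFun := fun x => ⟨x.level, (a : A)⁻¹ * x.pt * a⟩
          left_inv := fun x => by ext <;> simp [mul_assoc]
          right_inv := fun x => by ext <;> simp [mul_assoc]
          map_rel_iff' := by intro x y; exact hmono a x y }
      map_one' := by
        refine RelIso.ext fun x => ?_
        change (⟨_, _⟩ : CircularLift hf) = x
        ext <;> simp
      map_mul' := fun a b => by
        refine RelIso.ext fun x => ?_
        change (⟨_, _⟩ : CircularLift hf) = ⟨_, _⟩
        ext
        · rfl
        · change _ = (a : A) * ((b : A) * x.pt * (b : A)⁻¹) * (a : A)⁻¹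
          simp [mul_assoc] }
  refine LeftOrderable.of_ker ψ (LeftOrderable.orderIso _)
    (LeftOrderable.of_torsionFree (fun a b => ?_) (fun a n hn ha => ?_))
  · have h1 := congrArg (fun e : CircularLift hf ≃o CircularLift hf => (e ⟨0, (b : N)⟩).pt) a.2
    change ((a : N) : A) * ((b : N) : A) * ((a : N) : A)⁻¹ = ((b : N) : A) at h1
    ext
    exact mul_inv_eq_iff_eq_mul.1 h1
  · ext
    exact hN _ n (a : N).2 hn (by simpa [Subtype.ext_iff] using ha)

end IsCircularOrdering

open Classical in
/-- The inhomogeneous cocycle of a bi-invariant circular ordering `c` is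
`(1 - c 1 g (g * h)) / 2`, corrected by a coboundary supported where the triple is degenerate. -/
theorem BiCircularlyOrderable.exists_conj_invariant {A : Type*} [Group A]
    (hA : BiCircularlyOrderable A) :
    ∃ f : A → A → ℤ, IsCircularOrdering f ∧
      ∀ x a b, f (x * a * x⁻¹) (x * b * x⁻¹) = f a b := by
  obtain ⟨c, hc⟩ := hA
  let e : A → ℤ := fun g => if g = 1 then 1 else 0
  have e1 : e 1 = 1 := if_pos rfl
  have e0 : ∀ g, g ≠ 1 → e g = 0 := fun g hg => if_neg hg
  have key : ∀ g h, ∃ k : ℤ, (k = 0 ∨ k = 1) ∧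
      2 * k = 1 - c 1 g (g * h) - e g - e h + e (g * h) := by
    intro g h
    have hz := hc.eq_zero_iff 1 g (g * h)
    by_cases hg : g = 1
    · subst hg
      refine ⟨0, Or.inl rfl, ?_⟩
      rw [hz.2 (Or.inl rfl), e1, one_mul]; ring
    by_cases hh : h = 1
    · subst hh
      refine ⟨0, Or.inl rfl, ?_⟩
      rw [hz.2 (Or.inr (Or.inl (mul_one g).symm)), e1, mul_one]; ring
    by_cases hgh : g * h = 1
    · refine ⟨1, Or.inr rfl, ?_⟩
      rw [hz.2 (Or.inr (Or.inr hgh.symm)), hgh, e1, e0 g hg, e0 h hh]; ring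
    rw [e0 g hg, e0 h hh, e0 _ hgh]
    have hne : c 1 g (g * h) ≠ 0 := by
      intro h0
      rcases hz.1 h0 with h1 | h1 | h1
      · exact hg h1.symm
      · exact hh (by simpa using h1)
      · exact hgh h1.symm
    rcases (hc.values 1 g (g * h)).resolve_left hne with h1 | h1
    · exact ⟨0, Or.inl rfl, by rw [h1]; ring⟩
    · exact ⟨1, Or.inr rfl, by rw [h1]; ring⟩
  choose f hf01 hf using key
  refine ⟨f, ⟨⟨fun g => ?_, fun g => ?_, fun g h k => ?_⟩, hf01, fun g hg => ?_⟩, fun x a b => ?_⟩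
  · have := hf 1 g
    rw [(hc.eq_zero_iff _ _ _).2 (Or.inl rfl), one_mul, e1] at this
    omega
  · have := hf g 1
    rw [(hc.eq_zero_iff _ _ _).2 (Or.inr (Or.inl (mul_one g).symm)), mul_one, e1] at this
    omega
  · have h1 := hf h k
    have h2 := hf (g * h) k
    have h3 := hf g (h * k)
    have h4 := hf g h
    have h5 := hc.cocycle 1 g (g * h) (g * h * k)
    have h6 := hc.left_inv g 1 h (h * k)
    rw [mul_one, ← mul_assoc] at h6
    rw [← mul_assoc] at h3
    rw [mul_assoc g h k] at *
    omega
  · have := hf g g⁻¹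
    rw [mul_inv_cancel, (hc.eq_zero_iff _ _ _).2 (Or.inr (Or.inr rfl)), e1, e0 g hg,
      e0 g⁻¹ (by simpa using hg)] at this
    omega
  · have he : ∀ a, e (x * a * x⁻¹) = e a := by
      intro a
      by_cases ha : a = 1
      · subst ha; simp
      · rw [e0 a ha, e0 _ (by simpa [mul_inv_eq_one] using ha)]
    have h1 := hf (x * a * x⁻¹) (x * b * x⁻¹)
    have h2 := hf a b
    have h3 : x * a * x⁻¹ * (x * b * x⁻¹) = x * (a * b) * x⁻¹ := by group
    have h4 := hc.right_inv x⁻¹ (x * 1) (x * a) (x * (a * b))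
    rw [hc.left_inv, mul_one, mul_inv_cancel] at h4
    rw [h3, he, he, he, h4] at h1
    omega

/-! ### Localizations of the integers -/

theorem exists_injective_zmod_hom {B : Type*} [AddGroup B] (b : B) :
    ∃ φ : ZMod (addOrderOf b) →+ B, Function.Injective φ ∧ ∀ k : ℤ, φ k = k • b := by
  have h0 : zmultiplesHom B b (addOrderOf b : ℤ) = 0 := by
    simp [zmultiplesHom_apply, addOrderOf_nsmul_eq_zero]
  refine ⟨ZMod.lift _ ⟨zmultiplesHom B b, h0⟩, ?_, fun k => by simp⟩
  rw [ZMod.lift_injective]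
  intro m hm
  rw [ZMod.intCast_zmod_eq_zero_iff_dvd]
  exact addOrderOf_dvd_iff_zsmul_eq_zero.2 (by simpa using hm)

/-- The rational numbers whose denominator has all its prime factors in `S`, that is `ℤ[S⁻¹]`. -/
def localizedInt (S : Set ℕ) : AddSubgroup ℚ where
  carrier := {q | ∀ p : ℕ, p.Prime → p ∣ q.den → p ∈ S}
  zero_mem' := fun p hp h => absurd h (by simpa using hp.one_lt.ne')
  add_mem' := fun {q r} hq hr p hp h =>
    ((hp.dvd_mul).1 (h.trans (Rat.add_den_dvd q r))).elim (hq p hp) (hr p hp)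
  neg_mem' := fun {q} hq p hp h => hq p hp (by simpa using h)

theorem mem_localizedInt {S : Set ℕ} {q : ℚ} :
    q ∈ localizedInt S ↔ ∀ p : ℕ, p.Prime → p ∣ q.den → p ∈ S := Iff.rfl

theorem intCast_mem_localizedInt (S : Set ℕ) (k : ℤ) : (k : ℚ) ∈ localizedInt S :=
  mem_localizedInt.2 fun p hp h => absurd h (by simpa using hp.one_lt.ne')

theorem mem_localizedInt_of_mul {S : Set ℕ} {p : ℕ} (hp : p.Prime) (hpS : p ∈ S) {q : ℚ}
    (h : p * q ∈ localizedInt S) : q ∈ localizedInt S := by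
  have hp0 : (p : ℚ) ≠ 0 := by exact_mod_cast hp.ne_zero
  have h1 : (p : ℚ)⁻¹ ∈ localizedInt S := by
    refine mem_localizedInt.2 fun r hr hd => ?_
    rw [Rat.inv_natCast_den_of_pos hp.pos] at hd
    rwa [(Nat.prime_dvd_prime_iff_eq hr hp).1 hd]
  refine mem_localizedInt.2 fun r hr hd => ?_
  have h2 : q = (p : ℚ)⁻¹ * (p * q) := by field_simp
  rw [h2] at hd
  exact ((hr.dvd_mul).1 (hd.trans (Rat.mul_den_dvd _ _))).elim (h1 r hr) (h r hr)

/-- The group `ℚ ⧸ ℤ[S⁻¹]` is the increasing union of the finite cyclic groups generated by the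
classes of `1 / n!`, whose orders are prime to `S`. -/
theorem circularlyOrderable_prod_quotient {G : Type*} [Group G] {S : Set ℕ}
    (hS : ∀ p ∈ S, p.Prime)
    (hG : ∀ n : ℕ, 0 < n → (∀ p ∈ S, ¬ p ∣ n) →
      CircularlyOrderable (G × Multiplicative (ZMod n))) :
    CircularlyOrderable (G × Multiplicative (ℚ ⧸ localizedInt S)) := by
  let x : ℕ → ℚ ⧸ localizedInt S := fun n => ((1 / n.factorial : ℚ) : ℚ ⧸ localizedInt S)
  have hsmul : ∀ (n : ℕ) (k : ℕ), k • x n = ((k * (1 / n.factorial) : ℚ) : ℚ ⧸ localizedInt S) := by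
    intro n k
    rw [← nsmul_eq_mul]
    rfl
  have hpos : ∀ n, 0 < addOrderOf (x n) := by
    intro n
    rw [addOrderOf_pos_iff, isOfFinAddOrder_iff_nsmul_eq_zero]
    refine ⟨n.factorial, n.factorial_pos, ?_⟩
    have h0 : (n.factorial : ℚ) ≠ 0 := by exact_mod_cast n.factorial_ne_zero
    rw [hsmul, QuotientAddGroup.eq_zero_iff, mul_one_div_cancel h0]
    simpa using intCast_mem_localizedInt S 1
  have hprime : ∀ n, ∀ p ∈ S, ¬ p ∣ addOrderOf (x n) := by
    rintro n p hp ⟨k, hk⟩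
    have h1 : p • (k • x n) = 0 := by
      rw [smul_smul, ← hk, addOrderOf_nsmul_eq_zero]
    have h2 : k • x n = 0 := by
      rw [smul_smul, hsmul, QuotientAddGroup.eq_zero_iff, Nat.cast_mul, mul_assoc] at h1
      rw [hsmul, QuotientAddGroup.eq_zero_iff]
      exact mem_localizedInt_of_mul (hS p hp) hp h1
    have h3 := addOrderOf_dvd_of_nsmul_eq_zero h2
    have hk0 : 0 < k := Nat.pos_of_ne_zero fun h => (hpos n).ne' (by rw [hk, h, mul_zero])
    have h4 := Nat.le_of_dvd hk0 h3
    rw [hk] at h4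
    have := (hS p hp).two_le
    nlinarith
  choose φ hφ hφk using fun n => exists_injective_zmod_hom (x n)
  have hsurj : ∀ w, ∀ᶠ n in atTop, φ n (Function.invFun (φ n) w) = w := by
    intro w
    obtain ⟨q, rfl⟩ := QuotientAddGroup.mk_surjective w
    filter_upwards [eventually_ge_atTop q.den] with n hn
    obtain ⟨d, hd⟩ := Nat.dvd_factorial q.den_pos hn
    refine Function.invFun_eq ⟨((q.num * d : ℤ) : ZMod _), ?_⟩
    rw [hφk]
    have h0 : (n.factorial : ℚ) ≠ 0 := by exact_mod_cast n.factorial_ne_zero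
    have h1 : q = (q.num * d : ℤ) • (1 / n.factorial : ℚ) := by
      have h2 : (n.factorial : ℚ) = q.den * d := by exact_mod_cast hd
      have h3 : (q.den : ℚ) * q = q.num := Rat.den_mul_eq_num q
      rw [zsmul_eq_mul, mul_one_div, eq_div_iff h0, h2]
      push_cast
      rw [← h3]
      ring
    conv_rhs => rw [h1]
    rfl
  refine CircularlyOrderable.of_eventually (fun n => hG _ (hpos n) (hprime n))
    (fun n y => (y.1, Multiplicative.ofAdd (Function.invFun (φ n) y.2.toAdd))) ?_ ?_
  · intro y z
    filter_upwards [hsurj y.2.toAdd, hsurj z.2.toAdd, hsurj (y * z).2.toAdd] with n h1 h2 h3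
    refine Prod.ext rfl ?_
    refine congrArg Multiplicative.ofAdd (hφ n ?_)
    refine h3.trans (Eq.trans ?_ (map_add (φ n) _ _).symm)
    exact (congrArg₂ (· + ·) h1 h2).symm
  · intro y hy
    filter_upwards [hsurj y.2.toAdd] with n h1 h2
    refine hy (Prod.ext (show y.1 = 1 from congrArg Prod.fst h2) ?_)
    have h3 : Function.invFun (φ n) y.2.toAdd = 0 := congrArg Prod.snd h2
    rw [h3, map_zero] at h1
    exact h1.symm

/-- The rotation number, pushed to `ℚ ⧸ ℤ[S⁻¹]` by a `ℚ`-linear retraction `ℝ → ℚ`. -/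
theorem exists_hom_quotient {A : Type*} [Group A] {f : A → A → ℤ} (hf : IsCircularOrdering f)
    (hconj : ∀ x a b, f (x * a * x⁻¹) (x * b * x⁻¹) = f a b) (S : Set ℕ) :
    ∃ θ : A →* Multiplicative (ℚ ⧸ localizedInt S),
      ∀ (a : A) (p : ℕ), p.Prime → p ∉ S → a ^ p = 1 → θ a = 1 → a = 1 := by
  obtain ⟨τ, hτ, htor⟩ := hf.exists_rotation hconj
  obtain ⟨r, hr⟩ := LinearMap.exists_leftInverse_of_injective (Algebra.linearMap ℚ ℝ)
    (LinearMap.ker_eq_bot.2 (algebraMap ℚ ℝ).injective)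
  have hrq : ∀ q : ℚ, r (q : ℝ) = q := fun q => by
    simpa using LinearMap.congr_fun hr q
  let θ : A →* Multiplicative (ℚ ⧸ localizedInt S) := MonoidHom.mk'
    (fun a => Multiplicative.ofAdd ((r (τ a) : ℚ) : ℚ ⧸ localizedInt S)) (fun a b => by
      rw [← ofAdd_add, ← QuotientAddGroup.mk_add, ← map_add, hτ, map_add]
      refine congrArg Multiplicative.ofAdd (QuotientAddGroup.eq.2 ?_)
      rw [neg_add_cancel_left]
      have := hrq (f a b)
      rw [Rat.cast_intCast] at this
      rw [this]
      exact intCast_mem_localizedInt S _)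
  refine ⟨θ, fun a p hp hpS ha hθ => ?_⟩
  obtain ⟨⟨l, hl⟩, hint⟩ := htor a p hp.pos ha
  have hp0 : (p : ℝ) ≠ 0 := by exact_mod_cast hp.ne_zero
  have h1 : τ a = ((l / p : ℚ) : ℝ) := by
    push_cast
    rw [eq_div_iff hp0, ← hl, mul_comm]
  have h2 : (l / p : ℚ) ∈ localizedInt S := by
    have h3 : ((r (τ a) : ℚ) : ℚ ⧸ localizedInt S) = 0 := hθ
    rwa [h1, hrq, QuotientAddGroup.eq_zero_iff] at h3
  have h3 : (l / p : ℚ).den ∣ p := by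
    have := Rat.den_dvd l p
    rw [Rat.divInt_eq_div, Int.cast_natCast] at this
    exact_mod_cast this
  rcases (Nat.dvd_prime hp).1 h3 with h4 | h4
  · refine hint (l / p : ℚ).num ?_
    rw [h1]
    exact_mod_cast ((Rat.den_eq_one_iff _).1 h4).symm
  · exact absurd (h2 p hp (by rw [h4])) hpS

/-! ### Products with a bi-invariantly circularly ordered group -/

/-- If `A` has no torsion at the primes of `S` and `G × ℤ/n` is circularly orderable for all `n`
prime to `S`, then so is `G × A`: it maps to `G × ℚ ⧸ ℤ[S⁻¹]` with a torsion-free, hence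
left-orderable, kernel. -/
theorem circularlyOrderable_prod {G A : Type*} [Group G] [Group A] (hA : BiCircularlyOrderable A)
    {S : Set ℕ} (hS : ∀ p ∈ S, p.Prime) (htor : ∀ p ∈ S, ∀ a : A, a ^ p = 1 → a = 1)
    (hG : ∀ n : ℕ, 0 < n → (∀ p ∈ S, ¬ p ∣ n) →
      CircularlyOrderable (G × Multiplicative (ZMod n))) :
    CircularlyOrderable (G × A) := by
  obtain ⟨f, hf, hconj⟩ := hA.exists_conj_invariant
  obtain ⟨θ, hθ⟩ := exists_hom_quotient hf hconj S
  have hker : LeftOrderable θ.ker := by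
    refine hf.leftOrderable_of_torsionFree_subgroup hconj θ.ker fun a n ha hn han => ?_
    by_contra hne
    -- Some power `a ^ k` of a torsion element has prime order.
    have hfin : 0 < orderOf a := orderOf_pos_iff.2 (isOfFinOrder_iff_pow_eq_one.2 ⟨n, hn, han⟩)
    have h1 : orderOf a ≠ 1 := by rwa [Ne, orderOf_eq_one_iff]
    have hp := Nat.minFac_prime h1
    set p := (orderOf a).minFac
    obtain ⟨k, hk⟩ : p ∣ orderOf a := Nat.minFac_dvd _
    have hb : (a ^ k) ^ p = 1 := by rw [← pow_mul, mul_comm, ← hk, pow_orderOf_eq_one]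
    have hb1 : a ^ k = 1 := by
      by_cases hpS : p ∈ S
      · exact htor p hpS _ hb
      · exact hθ _ p hp hpS hb (θ.ker.pow_mem ha k)
    have hk0 : 0 < k := Nat.pos_of_ne_zero fun h => hfin.ne' (by rw [hk, h, mul_zero])
    have h4 := Nat.le_of_dvd hk0 (orderOf_dvd_of_pow_eq_one hb1)
    rw [hk] at h4
    have := hp.two_le
    nlinarith
  have hmem : ∀ x : ((MonoidHom.id G).prodMap θ).ker, x.1.1 = 1 ∧ θ x.1.2 = 1 := fun x =>
    Prod.ext_iff.1 x.2
  refine CircularlyOrderable.of_ker ((MonoidHom.id G).prodMap θ)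
    (circularlyOrderable_prod_quotient hS hG) (LeftOrderable.of_injective
      (((MonoidHom.snd G A).comp (Subgroup.subtype _)).codRestrict θ.ker fun x => (hmem x).2)
      (fun x y hxy => ?_) hker)
  refine Subtype.ext (Prod.ext ?_ (congrArg Subtype.val hxy))
  rw [(hmem x).1, (hmem y).1]

/-- The rotation number would embed `ℤ/p × ℤ/p` in the `p`-torsion of the circle. -/
theorem not_circularlyOrderable_zmod_prod (p : ℕ) (hp : p.Prime) :
    ¬ CircularlyOrderable (Multiplicative (ZMod p) × Multiplicative (ZMod p)) := by
  rintro ⟨f, hf⟩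
  have : NeZero p := ⟨hp.ne_zero⟩
  obtain ⟨τ, hτ, htor⟩ := hf.exists_rotation (fun x a b => by
    rw [mul_comm x a, mul_comm x b, mul_inv_cancel_right, mul_inv_cancel_right])
  have hpow : ∀ a : Multiplicative (ZMod p) × Multiplicative (ZMod p), a ^ p = 1 := by
    intro a
    have : ∀ b : Multiplicative (ZMod p), b ^ p = 1 := fun b =>
      congrArg Multiplicative.ofAdd (show p • b.toAdd = 0 by simp)
    exact Prod.ext (this _) (this _)
  choose k hk using fun a => (htor a p hp.pos (hpow a)).1
  have hp0 : (p : ℝ) ≠ 0 := by exact_mod_cast hp.ne_zero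
  obtain ⟨a, b, hab, hkab⟩ : ∃ a b, a ≠ b ∧ ((k a : ℤ) : ZMod p) = k b := by
    refine Fintype.exists_ne_map_eq_of_card_lt (fun a => ((k a : ℤ) : ZMod p)) ?_
    rw [Fintype.card_prod, Fintype.card_multiplicative, ZMod.card]
    nlinarith [hp.two_le]
  obtain ⟨d, hd⟩ := (ZMod.intCast_eq_intCast_iff_dvd_sub _ _ _).1 hkab
  refine hab ?_
  have h1 : τ b - τ a = d := by
    have h2 : (k b : ℝ) - k a = p * d := by exact_mod_cast hd
    rw [← hk, ← hk, ← mul_sub] at h2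
    exact mul_left_cancel₀ hp0 h2
  have h3 := hτ (b * a⁻¹) a
  rw [inv_mul_cancel_right] at h3
  have h4 := (htor (b * a⁻¹) p hp.pos (hpow _)).2 (d + f (b * a⁻¹) a) (by push_cast; linarith)
  exact (mul_inv_eq_one.1 h4).symm

theorem exists_injective_zmod_of_pow_eq_one {A : Type*} [Group A] {p : ℕ} (hp : p.Prime) {a : A}
    (ha : a ^ p = 1) (ha1 : a ≠ 1) :
    ∃ φ : Multiplicative (ZMod p) →* A, Function.Injective φ := by
  have hord : addOrderOf (Additive.ofMul a) = p := by
    rw [addOrderOf_ofMul_eq_orderOf]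
    have := Fact.mk hp
    exact orderOf_eq_prime ha ha1
  obtain ⟨φ, hφ⟩ : ∃ φ : ZMod p →+ Additive A, Function.Injective φ := by
    obtain ⟨φ, hφ, -⟩ := exists_injective_zmod_hom (Additive.ofMul a)
    exact hord ▸ ⟨φ, hφ⟩
  exact ⟨AddMonoidHom.toMultiplicativeLeft φ, hφ⟩

/-! ### The obstruction spectrum -/

theorem circularlyOrderable_prod_zmod_of_not_mem {G : Type*} [Group G]
    (hG : CircularlyOrderable G) {n : ℕ} (hn : 0 < n)
    (h : ∀ p ∈ minDvd (obstructionSpectrum G), ¬ p ∣ n) :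
    CircularlyOrderable (G × Multiplicative (ZMod n)) := by
  by_contra hcon
  rcases Nat.lt_or_ge 1 n with h1 | h1
  · -- A least divisor of `n` in the obstruction spectrum is minimal for divisibility.
    have hex : ∃ m, m ∈ obstructionSpectrum G ∧ m ∣ n := ⟨n, ⟨h1, hcon⟩, dvd_rfl⟩
    classical
    obtain ⟨hm, hmn⟩ := Nat.find_spec hex
    refine h (Nat.find hex) ⟨hm, fun k hk hkm => ?_⟩ hmn
    exact le_antisymm (Nat.le_of_dvd (by have := hm.1; omega) hkm)
      (Nat.find_min' hex ⟨hk, hkm.trans hmn⟩)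
  · obtain rfl : n = 1 := by omega
    refine hcon (.of_injective (MonoidHom.fst _ _) (fun x y hxy => ?_) hG)
    exact Prod.ext hxy (Subsingleton.elim (α := ZMod 1) _ _)

theorem circularlyOrderable_zmod_prod {m n : ℕ} (hm : 0 < m) (hn : 0 < n) (h : m.Coprime n) :
    CircularlyOrderable (Multiplicative (ZMod m) × Multiplicative (ZMod n)) := by
  have : NeZero (m * n) := ⟨(Nat.mul_pos hm hn).ne'⟩
  let e := (ZMod.chineseRemainder h).symm
  refine .of_injective (MonoidHom.mk' (fun x => Multiplicative.ofAdd (e (x.1.toAdd, x.2.toAdd)))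
    fun x y => ?_) (fun x y hxy => ?_) (CircularlyOrderable.zmod (m * n))
  · rw [← ofAdd_add, ← map_add]
    rfl
  · have h1 := Prod.ext_iff.1 (e.injective (Multiplicative.ofAdd.injective hxy))
    exact Prod.ext h1.1 h1.2

theorem mainTheorem5 {G A : Type*} [Group G] [Group A]
    (hA : BiCircularlyOrderable A)
    (hG : CircularlyOrderable G)
    (hmin : ∀ n ∈ minDvd (obstructionSpectrum G), n.Prime) :
    CircularlyOrderable (G × A) ↔
      minDvd (obstructionSpectrum G) ∩ minDvd (obstructionSpectrum A) = ∅ := by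
  constructor
  · intro hGA
    rw [Set.eq_empty_iff_forall_notMem]
    rintro p ⟨hpG, hpA⟩
    have hp := hmin p hpG
    have htor : ∀ q ∈ ({p} : Set ℕ), ∀ a : A, a ^ q = 1 → a = 1 := by
      rintro q rfl a ha
      by_contra ha1
      obtain ⟨φ, hφ⟩ := exists_injective_zmod_of_pow_eq_one hp ha ha1
      refine hpG.1.2 (.of_injective ((MonoidHom.id G).prodMap φ) ?_ hGA)
      exact Function.injective_id.prodMap hφ
    let e : A × Multiplicative (ZMod p) ≃* Multiplicative (ZMod p) × A := MulEquiv.prodComm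
    refine hpA.1.2 (.of_injective e.toMonoidHom e.injective
      (circularlyOrderable_prod (S := {p}) hA ?_ htor fun n hn hpn => ?_))
    · rintro q rfl
      exact hp
    · exact circularlyOrderable_zmod_prod hp.pos hn ((hp.coprime_iff_not_dvd).2 (hpn p rfl))
  · intro hdisj
    refine circularlyOrderable_prod hA hmin (fun p hpG a ha => ?_)
      fun n hn h => circularlyOrderable_prod_zmod_of_not_mem hG hn h
    have hp := hmin p hpG
    by_contra ha1
    obtain ⟨φ, hφ⟩ := exists_injective_zmod_of_pow_eq_one hp ha ha1
    have hpA : p ∈ obstructionSpectrum A := ⟨hp.two_le, fun hco =>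
      not_circularlyOrderable_zmod_prod p hp (.of_injective (φ.prodMap (MonoidHom.id _))
        (hφ.prodMap Function.injective_id) hco)⟩
    refine (Set.eq_empty_iff_forall_notMem.1 hdisj p) ⟨hpG, hpA, fun m hm hmp => ?_⟩
    exact ((Nat.dvd_prime hp).1 hmp).resolve_left fun h => by have := hm.1; omega
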